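/- Consider the linear system $$x_{k+1}=(A+\delta\mathscr A)x_k+w_k,\qquad y_k=Cx_k+v_k,\qquad k=0,1,2,\dots,$$ with $x_k\in\mathbb R^n$, $y_k\in\mathbb R^p$, where $x_0\sim\mathcal N(0,P_0)$, $w_k\sim\mathcal N(0,Q_k)$, $v_k\sim\mathcal N(0,R_k)$ are mutually independent, $P_0>0$, $Q_k\ge 0$, $R_k>0$. The magnitude $\delta$ of the uncertainty lies in a set $\Delta\subseteq\mathbb R$, and its location matrix $\mathscr A$ is one of $M$ distinct candidates $\mathscr A_1,\dots,\mathscr A_M\in\mathbb R^{n\times n}$. Write $Y_k=(y_0,\dots,y_k)$. For each $i$ fix $\delta_i\in\Delta$, the magnitude under location $\mathscr A_i$ (for instance the same $\delta$ for all $i$), and let $p(Y_k\mid\mathscr A_i)$ be the Lebesgue density of $Y_k$ when $(\delta,\mathscr A)=(\delta_i,\mathscr A_i)$. Let $p(y_k\mid\mathscr A_i,Y_{k-1})=p(Y_k\mid\mathscr A_i)/p(Y_{k-1}\mid\mathscr A_i)$ and, for prior probabilities $p(\mathscr A_i)$, let $p(\mathscr A_i\mid Y_k)=p(\mathscr A_i)\,p(Y_k\mid\mathscr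 A_i)/\sum_j p(\mathscr A_j)\,p(Y_k\mid\mathscr A_j)$. Let $\mathscr A_t$ be the true location, i.e. the measurements are generated with $(\delta,\mathscr A)=(\delta_t,\mathscr A_t)$. Suppose that the system is (jointly) observable on $[0,K]$ for some $K\in\mathbb{N}$: whenever $x_0\ne 0$, $\delta\in\Delta$, $\mathscr A\in\{\mathscr A_1,\dots,\mathscr A_M\}$, no other triplet $(x_0',\delta',\mathscr A')$ with $x_0'\in\mathbb R^n$, $\delta'\in\Delta$, $\mathscr A'\in\{\mathscr A_1,\dots,\mathscr A_M\}$ yields the same noise-free ($w=0$, $v=0$) outputs $y_0,\dots,y_K$. Then for all $k\ge K$ and all $i\ne t$ the Kullback–Leibler divergence of the law of $Y_k$ under $\mathscr A_t$ from the law of $Y_k$ under $\mathscr A_i$ is strictly positive: $$D(\mathscr A_t\,\|\,\mathscr A_i)=\int p(Y_k\mid\mathscr A_t)\log\frac{p(Y_k\mid\mathscr A_t)}{p(Y_k\mid\mathscr A_i)}\,dY_k>0 .$$ If in addition $p(\mathscr A_i)=1/M$ for all $i$ and, for every $i$, the process $$\Bigl\{\log\frac{p(y_k\mid\mathscr A_t,Y_{k-1})}{p(y_k\mid\mathscr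 A_i,Y_{k-1})}\Bigr\}_{k\ge1}$$ is ergodic (strictly stationary, with the shift ergodic for its law) under $\mathscr A_t$, then for all $i\neq t$, almost surely, the limit $\lim_{k\to\infty}p(\mathscr A_t\mid Y_k)/p(\mathscr A_i\mid Y_k)$ exists in $[-\infty,\infty]$ and is greater than $1$; and $$\lim_{k\to\infty}\frac{p(\mathscr A_t\mid Y_k)}{p(\mathscr A_i\mid Y_k)}=\infty\quad\text{a.s.}$$ -/

import Mathlib

open MeasureTheory ProbabilityTheory Filter Topology

namespace UncertainLinear

/-- Data of the uncertain linear system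
`x (k+1) = (A + δ • 𝒜) x k + w k`, `y k = C x k + v k`, with state space `ℝⁿ` and output space `ℝᵖ`.
The uncertainty magnitude `δ` lies in `Δ`, and its location matrix `𝒜` is one of `M` distinct
candidates `loc i`. The matrices `P₀`, `Q k`, `R k` are the covariances of the initial state,
of the process noise and of the measurement noise. -/
structure Model (n p M : ℕ) where
  A : Matrix (Fin n) (Fin n) ℝ
  C : Matrix (Fin p) (Fin n) ℝ
  Δ : Set ℝ
  loc : Fin M → Matrix (Fin n) (Fin n) ℝ
  loc_injective : Function.Injective loc
  P₀ : Matrix (Fin n) (Fin n) ℝ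
  Q : ℕ → Matrix (Fin n) (Fin n) ℝ
  R : ℕ → Matrix (Fin p) (Fin p) ℝ
  P₀_posDef : P₀.PosDef
  Q_posSemidef : ∀ k, (Q k).PosSemidef
  R_posDef : ∀ k, (R k).PosDef

namespace Model

variable {n p M : ℕ} (S : Model n p M)

/-- The transition matrix `A + δ • 𝒜`. -/
def trans (δ : ℝ) (𝒜 : Matrix (Fin n) (Fin n) ℝ) : Matrix (Fin n) (Fin n) ℝ :=
  S.A + δ • 𝒜

/-- The state `x k` for magnitude `δ`, location `𝒜`, initial state `x₀`, process noise `w`. -/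
noncomputable def state (δ : ℝ) (𝒜 : Matrix (Fin n) (Fin n) ℝ) (x₀ : EuclideanSpace ℝ (Fin n))
    (w : ℕ → EuclideanSpace ℝ (Fin n)) : ℕ → EuclideanSpace ℝ (Fin n)
  | 0 => x₀
  | k + 1 => Matrix.toEuclideanLin (S.trans δ 𝒜) (state δ 𝒜 x₀ w k) + w k

/-- The output `y k`. -/
noncomputable def output (δ : ℝ) (𝒜 : Matrix (Fin n) (Fin n) ℝ) (x₀ : EuclideanSpace ℝ (Fin n))
    (w : ℕ → EuclideanSpace ℝ (Fin n)) (v : ℕ → EuclideanSpace ℝ (Fin p)) (k : ℕ) :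
    EuclideanSpace ℝ (Fin p) :=
  Matrix.toEuclideanLin S.C (S.state δ 𝒜 x₀ w k) + v k

/-- Two triplets are indistinguishable on `[0, K]` if their noise-free outputs agree there. -/
def Indistinguishable (K : ℕ)
    (a b : EuclideanSpace ℝ (Fin n) × ℝ × Matrix (Fin n) (Fin n) ℝ) : Prop :=
  ∀ k ≤ K, S.output a.2.1 a.2.2 a.1 0 0 k = S.output b.2.1 b.2.2 b.1 0 0 k

/-- The triplets `(x₀, δ, 𝒜)` with `δ ∈ Δ` and `𝒜` a candidate location. -/
def triplets : Set (EuclideanSpace ℝ (Fin n) × ℝ × Matrix (Fin n) (Fin n) ℝ) :=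
  {a | a.2.1 ∈ S.Δ ∧ a.2.2 ∈ Set.range S.loc}

/-- A triplet is observable on `[0, K]` if the set of triplets that are
indistinguishable from it on `[0, K]` consists of this triplet only. -/
def ObservableTriplet (K : ℕ)
    (a : EuclideanSpace ℝ (Fin n) × ℝ × Matrix (Fin n) (Fin n) ℝ) : Prop :=
  {b ∈ S.triplets | S.Indistinguishable K a b} = {a}

/-- The system is observable on `[0, K]` if every triplet with nonzero initial state is. (From the
initial state zero the noise-free output vanishes whatever `δ` and `𝒜` are.) -/
def Observable (K : ℕ) : Prop :=
  ∀ a ∈ S.triplets, a.1 ≠ 0 → S.ObservableTriplet K a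

variable {Ω : Type*} [MeasurableSpace Ω]

/-- `x₀`, `w k`, `v k` are centred Gaussian vectors with covariances `P₀`, `Q k`, `R k`,
all of them mutually independent. -/
structure IsNoise (P : Measure Ω) (x₀ : Ω → EuclideanSpace ℝ (Fin n))
    (w : ℕ → Ω → EuclideanSpace ℝ (Fin n)) (v : ℕ → Ω → EuclideanSpace ℝ (Fin p)) : Prop where
  measurable_x₀ : Measurable x₀
  measurable_w : ∀ k, Measurable (w k)
  measurable_v : ∀ k, Measurable (v k)
  law_x₀ : P.map x₀ = multivariateGaussian 0 S.P₀
  law_w : ∀ k, P.map (w k) = multivariateGaussian 0 (S.Q k)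
  law_v : ∀ k, P.map (v k) = multivariateGaussian 0 (S.R k)
  indep_w : iIndepFun w P
  indep_v : iIndepFun v P
  indep_w_v : IndepFun (fun ω k => w k ω) (fun ω k => v k ω) P
  indep_x₀ : IndepFun x₀ (fun ω => ((fun k => w k ω), (fun k => v k ω))) P

/-- The measurement record `(y 0, …, y k)` generated by the system under location `loc i`, when the
magnitude of the uncertainty under location `loc i` is `d i`. -/
noncomputable def record (d : Fin M → ℝ) (x₀ : Ω → EuclideanSpace ℝ (Fin n))
    (w : ℕ → Ω → EuclideanSpace ℝ (Fin n)) (v : ℕ → Ω → EuclideanSpace ℝ (Fin p))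
    (i : Fin M) (k : ℕ) (ω : Ω) : Fin (k + 1) → EuclideanSpace ℝ (Fin p) :=
  fun j => S.output (d i) (S.loc i) (x₀ ω) (fun m => w m ω) (fun m => v m ω) j

/-- The likelihood `p(Y_k | 𝒜ᵢ)`: the Lebesgue density of the law of the record under location
`loc i`. -/
noncomputable def lik (P : Measure Ω) (d : Fin M → ℝ) (x₀ : Ω → EuclideanSpace ℝ (Fin n))
    (w : ℕ → Ω → EuclideanSpace ℝ (Fin n)) (v : ℕ → Ω → EuclideanSpace ℝ (Fin p))
    (i : Fin M) (k : ℕ) (Y : Fin (k + 1) → EuclideanSpace ℝ (Fin p)) : ℝ :=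
  (pdf (S.record d x₀ w v i k) P volume Y).toReal

/-- The conditional density `p(y_{k+1} | 𝒜ᵢ, Y_k)`, a function of `(y 0, …, y (k+1))`. -/
noncomputable def condLik (P : Measure Ω) (d : Fin M → ℝ) (x₀ : Ω → EuclideanSpace ℝ (Fin n))
    (w : ℕ → Ω → EuclideanSpace ℝ (Fin n)) (v : ℕ → Ω → EuclideanSpace ℝ (Fin p))
    (i : Fin M) (k : ℕ) (Y : Fin (k + 2) → EuclideanSpace ℝ (Fin p)) : ℝ :=
  S.lik P d x₀ w v i (k + 1) Y / S.lik P d x₀ w v i k (Fin.init Y)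

/-- The log-likelihood-ratio increment `log (p(y_{k+1} | 𝒜ₜ, Y_k) / p(y_{k+1} | 𝒜ᵢ, Y_k))` along
the record that is generated under the true location `loc t`. -/
noncomputable def llrIncrement (P : Measure Ω) (d : Fin M → ℝ)
    (x₀ : Ω → EuclideanSpace ℝ (Fin n)) (w : ℕ → Ω → EuclideanSpace ℝ (Fin n))
    (v : ℕ → Ω → EuclideanSpace ℝ (Fin p)) (t i : Fin M) (k : ℕ) (ω : Ω) : ℝ :=
  Real.log (S.condLik P d x₀ w v t k (S.record d x₀ w v t (k + 1) ω) /
    S.condLik P d x₀ w v i k (S.record d x₀ w v t (k + 1) ω))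

/-- The posterior probability `p(𝒜ᵢ | Y_k)` of location `loc i` given the record, by Bayes' rule
from the prior probabilities of the locations. -/
noncomputable def posterior (P : Measure Ω) (d : Fin M → ℝ) (x₀ : Ω → EuclideanSpace ℝ (Fin n))
    (w : ℕ → Ω → EuclideanSpace ℝ (Fin n)) (v : ℕ → Ω → EuclideanSpace ℝ (Fin p))
    (prior : PMF (Fin M)) (i : Fin M) (k : ℕ)
    (Y : Fin (k + 1) → EuclideanSpace ℝ (Fin p)) : ℝ :=
  (prior i).toReal * S.lik P d x₀ w v i k Y /
    ∑ j, (prior j).toReal * S.lik P d x₀ w v j k Y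

end Model

/-- A real-valued process indexed by `ℕ` is ergodic if the shift of sequences preserves the law of
the process (stationarity) and is ergodic with respect to it. -/
def IsErgodicProcess {Ω : Type*} [MeasurableSpace Ω] (P : Measure Ω) (X : ℕ → Ω → ℝ) : Prop :=
  (∀ k, AEMeasurable (X k) P) ∧
    Ergodic (fun (s : ℕ → ℝ) (k : ℕ) => s (k + 1)) (P.map (fun ω k => X k ω))

end UncertainLinear

/-! Two locations are separated by second moments. The covariance of `y_j` with `y_0` is `C F^j P₀
Cᵀ`, where `F` is the transition matrix, plus a noise term that does not depend on the location. If
two records had the same law, the noise-free outputs from each initial state `P₀ Cᵀ b` would agree,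
against observability if one of these states is nonzero. If all vanish, then `C = 0`, since `P₀` is
invertible, and no state is observable. So the laws differ (`IsNoise.map_record_ne`) and the
divergence is positive.

As `R_k > 0`, every record law is equivalent to Lebesgue measure. Hence likelihoods are almost
surely positive and log-likelihood ratios are `llr` of the laws. They are partial sums of the
increments, that is, Birkhoff sums of a coordinate under the shift. By stationarity `k` times the
mean increment is a divergence, hence positive. Birkhoff sums with positive mean tend to infinity;
the maximal ergodic inequality suffices for this. A non-integrable increment still has integrable
negative part, and truncation reduces to the integrable case. -/

/-! ### Divergence of Birkhoff sums. -/

section Ergodic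

variable {α : Type*} [MeasurableSpace α] {μ : Measure α} {T : α → α}

/-- If the Birkhoff sums of an integrable function are almost everywhere unbounded above, then the
integral of the function is nonnegative (a form of the maximal ergodic theorem). -/
theorem MeasureTheory.MeasurePreserving.integral_nonneg_of_not_bddAbove_birkhoffSum
    (hT : MeasurePreserving T μ μ) {h : α → ℝ} (hh : Integrable h μ)
    (hunb : ∀ᵐ x ∂μ, ¬ BddAbove (Set.range fun n => birkhoffSum T h n x)) :
    0 ≤ ∫ x, h x ∂μ := by
  -- `m n x` is the maximum of the Birkhoff sums of lengths `1, …, n + 1`, in recursive form.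
  let m : ℕ → α → ℝ := fun n => Nat.rec h (fun _ g x => h x + max 0 (g (T x))) n
  have m_zero : m 0 = h := rfl
  have m_succ (n x) : m (n + 1) x = h x + max 0 (m n (T x)) := rfl
  have m_int (n) : Integrable (m n) μ := by
    induction n with
    | zero => exact hh
    | succ n ih => exact hh.add ((integrable_zero α ℝ μ).sup (hT.integrable_comp_of_integrable ih))
  have m_mono (n) : ∀ x, m n x ≤ m (n + 1) x := by
    induction n with
    | zero => intro x; rw [m_succ, m_zero]; linarith [le_max_left 0 (h (T x))]
    | succ n ih => intro x; rw [m_succ n, m_succ (n + 1)]; gcongr; exact ih _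
  have m_monotone (x) : Monotone fun n => m n x := monotone_nat_of_le_succ fun n => m_mono n x
  have h_le (n x) : h x ≤ m n x := m_monotone x (Nat.zero_le n)
  have sum_le (n) : ∀ x, birkhoffSum T h (n + 1) x ≤ m n x := by
    induction n with
    | zero => intro x; simp [m_zero]
    | succ n ih =>
      intro x
      rw [birkhoffSum_succ', m_succ]
      gcongr
      exact (ih _).trans (le_max_right _ _)
  -- Integrate `m n ≤ m (n + 1) = h + max 0 (m n ∘ T)`; invariance removes `T`, and `m - max 0 m =
  -- min 0 m`.
  have key (n) : ∫ x, min 0 (m n x) ∂μ ≤ ∫ x, h x ∂μ := by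
    have hpos : Integrable (fun x => max 0 (m n x)) μ := (integrable_zero α ℝ μ).sup (m_int n)
    have e1 : ∫ x, m (n + 1) x ∂μ = ∫ x, h x ∂μ + ∫ x, max 0 (m n x) ∂μ := by
      have hcomp : Integrable (fun x => max 0 (m n (T x))) μ :=
        hT.integrable_comp_of_integrable hpos
      have e2 : ∫ x, max 0 (m n (T x)) ∂μ = ∫ x, max 0 (m n x) ∂μ := by
        conv_rhs => rw [← hT.map_eq]
        rw [integral_map hT.measurable.aemeasurable]
        rw [hT.map_eq]; exact hpos.aestronglyMeasurable
      rw [← e2, ← integral_add hh hcomp]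
    have hmin : Integrable (fun x => min 0 (m n x)) μ := (integrable_zero α ℝ μ).inf (m_int n)
    have e3 : ∫ x, m n x ∂μ = ∫ x, min 0 (m n x) ∂μ + ∫ x, max 0 (m n x) ∂μ := by
      rw [← integral_add hmin hpos]
      exact integral_congr_ae (.of_forall fun x => by simp [min_add_max])
    have := integral_mono (m_int n) (m_int (n + 1)) (m_mono n)
    linarith
  have lim : Tendsto (fun n => ∫ x, min 0 (m n x) ∂μ) atTop (𝓝 (∫ _, (0 : ℝ) ∂μ)) := by
    refine tendsto_integral_of_dominated_convergence (fun x => ‖h x‖)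
      (fun n => ((integrable_zero α ℝ μ).inf (m_int n)).aestronglyMeasurable) hh.norm
      (fun n => .of_forall fun x => ?_) ?_
    · rw [Real.norm_eq_abs, Real.norm_eq_abs, abs_of_nonpos (min_le_left _ _)]
      rcases min_cases 0 (m n x) with h' | h'
      · rw [h'.1]; simp
      · rw [h'.1]; linarith [h_le n x, neg_le_abs (h x)]
    · filter_upwards [hunb] with x hx
      -- Once one Birkhoff sum is positive, `min 0 (m n x)` is zero from then on.
      obtain ⟨_, ⟨N, rfl⟩, hN⟩ := not_bddAbove_iff.1 hx 0
      refine tendsto_const_nhds.congr' ?_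
      filter_upwards [eventually_ge_atTop N] with n hn
      refine (min_eq_left ?_).symm
      cases N with
      | zero => simp at hN
      | succ N => exact hN.le.trans ((sum_le N x).trans (m_monotone x (by omega)))
  rw [integral_zero] at lim
  exact le_of_tendsto' lim key

/-- The Birkhoff sums of a function with positive integral tend to infinity almost everywhere. -/
theorem Ergodic.tendsto_birkhoffSum_atTop [IsProbabilityMeasure μ] (hT : Ergodic T μ) {f : α → ℝ}
    (hfm : Measurable f) (hf : Integrable f μ) (hpos : 0 < ∫ x, f x ∂μ) :
    ∀ᵐ x ∂μ, Tendsto (fun n => birkhoffSum T f n x) atTop atTop := by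
  -- Half the mean: `ε - f` still has negative integral, and an upper bound `c` on its sums gives `n
  -- ε - c` below those of `f`.
  set ε := (∫ x, f x ∂μ) / 2 with hε
  have εpos : 0 < ε := by positivity
  let h : α → ℝ := fun x => ε - f x
  have hsum (n x) : birkhoffSum T h n x = n * ε - birkhoffSum T f n x := by
    simp [birkhoffSum, h, Finset.sum_sub_distrib]
  have hint : Integrable h μ := (integrable_const _).sub hf
  have hneg : ∫ x, h x ∂μ < 0 := by
    rw [integral_sub (integrable_const _) hf]
    simp only [integral_const, probReal_univ, one_smul]
    linarith
  let B : Set α := {x | BddAbove (Set.range fun n => birkhoffSum T h n x)}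
  have hBm : MeasurableSet B := by
    refine measurableSet_bddAbove_range fun n => ?_
    have : Measurable h := by fun_prop
    exact Finset.measurable_sum _ fun k _ => this.comp (hT.measurable.iterate k)
  -- Passing from `x` to `T x` shifts the sums by the constant `h x`, so boundedness is unaffected.
  have hBinv : T ⁻¹' B = B := by
    ext x
    simp only [B, Set.mem_preimage, Set.mem_ofPred_eq]
    constructor
    · rintro ⟨c, hc⟩
      refine ⟨max 0 (h x + c), ?_⟩
      rintro _ ⟨n, rfl⟩
      cases n with
      | zero => simp
      | succ n =>
        simp only [birkhoffSum_succ']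
        exact le_max_of_le_right (by gcongr; exact hc ⟨n, rfl⟩)
    · rintro ⟨c, hc⟩
      refine ⟨c - h x, ?_⟩
      rintro _ ⟨n, rfl⟩
      have := hc ⟨n + 1, rfl⟩
      simp only [birkhoffSum_succ'] at this
      simp only
      linarith
  have hB : ∀ᵐ x ∂μ, x ∈ B := by
    rcases hT.prob_eq_zero_or_one hBm hBinv with h0 | h1
    · refine absurd ?_ hneg.not_ge
      refine hT.toMeasurePreserving.integral_nonneg_of_not_bddAbove_birkhoffSum hint ?_
      exact measure_eq_zero_iff_ae_notMem.1 h0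
    · exact (mem_ae_iff_prob_eq_one hBm).2 h1
  filter_upwards [hB] with x ⟨c, hc⟩
  have hlin : Tendsto (fun n : ℕ => (n : ℝ) * ε - c) atTop atTop :=
    tendsto_atTop_add_const_right _ (-c) (tendsto_natCast_atTop_atTop.atTop_mul_const εpos)
  refine tendsto_atTop_mono (fun n => ?_) hlin
  have := hc ⟨n, rfl⟩
  simp only [hsum] at this
  linarith

/-- The Birkhoff sums of a function with integrable negative part tend to infinity almost
everywhere, if the function is not integrable. -/
theorem Ergodic.tendsto_birkhoffSum_atTop_of_not_integrable [IsProbabilityMeasure μ]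
    (hT : Ergodic T μ) {f : α → ℝ} (hfm : Measurable f)
    (hneg : Integrable (fun x => max (-f x) 0) μ) (hf : ¬ Integrable f μ) :
    ∀ᵐ x ∂μ, Tendsto (fun n => birkhoffSum T f n x) atTop atTop := by
  have hint (n : ℕ) : Integrable (fun x => min (f x) n) μ := by
    refine (hneg.add (integrable_const (n : ℝ))).mono' (by fun_prop) (.of_forall fun x => ?_)
    have hn : (0 : ℝ) ≤ n := n.cast_nonneg
    simp only [Pi.add_apply, Real.norm_eq_abs]
    rw [abs_le]
    have h1 := le_max_left (-f x) 0
    have h2 := le_max_right (-f x) 0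
    have h3 := min_le_right (f x) n
    constructor
    · exact le_min (by linarith) (by linarith)
    · linarith
  -- If every truncation had nonpositive integral, monotone convergence would bound the positive
  -- part of `f` by the integral of the negative part, making `f` integrable.
  obtain ⟨n, hn⟩ : ∃ n : ℕ, 0 < ∫ x, min (f x) n ∂μ := by
    by_contra! hle
    refine hf ⟨hfm.aestronglyMeasurable, ?_⟩
    set g : α → ℝ := fun x => max (-f x) 0
    have hbound (n : ℕ) : ∫⁻ x, ENNReal.ofReal (min (f x) n) ∂μ ≤ ENNReal.ofReal (∫ x, g x ∂μ) := by
      have hp : ∀ x, 0 ≤ min (f x) n + g x := fun x => by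
        have := le_max_left (-f x) 0
        have h2 := le_max_right (-f x) 0
        have hn : (0 : ℝ) ≤ n := n.cast_nonneg
        rcases min_cases (f x) n with h | h <;> rw [h.1] <;> simp only [g] <;> linarith
      calc ∫⁻ x, ENNReal.ofReal (min (f x) n) ∂μ
          ≤ ∫⁻ x, ENNReal.ofReal (min (f x) n + g x) ∂μ := by
            refine lintegral_mono fun x => ENNReal.ofReal_le_ofReal ?_
            linarith [le_max_right (-f x) 0]
        _ = ENNReal.ofReal (∫ x, (min (f x) n + g x) ∂μ) :=
            (ofReal_integral_eq_lintegral_ofReal ((hint n).add hneg) (.of_forall hp)).symm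
        _ ≤ _ := by
            refine ENNReal.ofReal_le_ofReal ?_
            rw [integral_add (hint n) hneg]
            linarith [hle n]
    have hpos : ∫⁻ x, ENNReal.ofReal (f x) ∂μ ≤ ENNReal.ofReal (∫ x, g x ∂μ) := by
      have hsup : ∀ x, ENNReal.ofReal (f x) = ⨆ n : ℕ, ENNReal.ofReal (min (f x) n) := fun x => by
        refine le_antisymm ?_ (iSup_le fun n => ENNReal.ofReal_le_ofReal (min_le_left _ _))
        obtain ⟨n, hn⟩ := exists_nat_ge (f x)
        exact le_iSup_of_le n (by rw [min_eq_left hn])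
      simp_rw [hsup]
      rw [lintegral_iSup (fun n => by fun_prop)]
      · exact iSup_le hbound
      · intro a b hab x
        exact ENNReal.ofReal_le_ofReal (min_le_min le_rfl (Nat.cast_le.2 hab))
    rw [hasFiniteIntegral_iff_norm]
    calc ∫⁻ x, ENNReal.ofReal ‖f x‖ ∂μ
        ≤ ∫⁻ x, (ENNReal.ofReal (f x) + ENNReal.ofReal (g x)) ∂μ := by
          refine lintegral_mono fun x => ?_
          rcases le_total 0 (f x) with h | h
          · rw [Real.norm_of_nonneg h]; exact le_self_add
          · rw [Real.norm_of_nonpos h]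
            exact le_add_left (ENNReal.ofReal_le_ofReal (le_max_left _ _))
      _ = ∫⁻ x, ENNReal.ofReal (f x) ∂μ + ∫⁻ x, ENNReal.ofReal (g x) ∂μ :=
          lintegral_add_left (by fun_prop) _
      _ < ⊤ := by
          refine ENNReal.add_lt_top.2 ⟨hpos.trans_lt ENNReal.ofReal_lt_top, ?_⟩
          exact hneg.lintegral_lt_top
  filter_upwards [hT.tendsto_birkhoffSum_atTop (by fun_prop) (hint n) hn] with x hx
  exact tendsto_atTop_mono (fun k => Finset.sum_le_sum fun j _ => min_le_left _ _) hx

end Ergodic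

/-! ### Null sets of Gaussian laws. -/

theorem MeasureTheory.Measure.AbsolutelyContinuous.pi_fin {n : ℕ} {X : Type*} [MeasurableSpace X]
    {μ ν : Fin n → Measure X} [∀ i, SigmaFinite (μ i)] [∀ i, SigmaFinite (ν i)]
    (h : ∀ i, μ i ≪ ν i) : Measure.pi μ ≪ Measure.pi ν := by
  induction n with
  | zero => rw [Measure.pi_of_empty μ, Measure.pi_of_empty ν]
  | succ n ih =>
    rw [← (measurePreserving_piFinSuccAbove μ 0).symm.map_eq,
      ← (measurePreserving_piFinSuccAbove ν 0).symm.map_eq]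
    exact ((h 0).prod (ih fun i => h _)).map (MeasurableEquiv.measurable _)

theorem stdGaussian_absolutelyContinuous (p : ℕ) :
    stdGaussian (EuclideanSpace ℝ (Fin p)) ≪ volume := by
  rw [← map_pi_eq_stdGaussian, ← (PiLp.volume_preserving_toLp (Fin p)).map_eq, volume_pi]
  exact (Measure.AbsolutelyContinuous.pi_fin fun _ =>
    gaussianReal_absolutelyContinuous 0 one_ne_zero).map (by fun_prop)

theorem absolutelyContinuous_stdGaussian (p : ℕ) :
    volume ≪ stdGaussian (EuclideanSpace ℝ (Fin p)) := by
  rw [← map_pi_eq_stdGaussian, ← (PiLp.volume_preserving_toLp (Fin p)).map_eq, volume_pi]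
  exact (Measure.AbsolutelyContinuous.pi_fin fun _ =>
    gaussianReal_absolutelyContinuous' 0 one_ne_zero).map (by fun_prop)

open Matrix MatrixOrder in
theorem Matrix.PosDef.exists_linearEquiv_sqrt {p : ℕ} {R : Matrix (Fin p) (Fin p) ℝ}
    (hR : R.PosDef) : ∃ e : EuclideanSpace ℝ (Fin p) ≃ₗ[ℝ] EuclideanSpace ℝ (Fin p),
      ∀ x, e x = toEuclideanCLM (𝕜 := ℝ) (CFC.sqrt R) x := by
  have hu : IsUnit (CFC.sqrt R) := by
    rw [CFC.isUnit_sqrt_iff R hR.posSemidef.nonneg]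
    exact hR.isUnit
  have hu' : IsUnit (toEuclideanCLM (𝕜 := ℝ) (CFC.sqrt R)) := hu.map (toEuclideanCLM (𝕜 := ℝ))
  obtain ⟨u, hu'⟩ := hu'
  refine ⟨(ContinuousLinearEquiv.ofUnit u).toLinearEquiv, fun x => ?_⟩
  rw [← hu']
  rfl

theorem LinearEquiv.absolutelyContinuous_map_volume {E : Type*} [NormedAddCommGroup E]
    [InnerProductSpace ℝ E] [FiniteDimensional ℝ E] [MeasurableSpace E] [BorelSpace E]
    (e : E ≃ₗ[ℝ] E) :
    (volume : Measure E).map e ≪ volume ∧ (volume : Measure E) ≪ volume.map e := by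
  have h := Measure.map_linearMap_addHaar_eq_smul_addHaar (μ := (volume : Measure E))
    (f := (e : E →ₗ[ℝ] E)) e.isUnit_det'.ne_zero
  rw [LinearEquiv.coe_coe] at h
  rw [h]
  refine ⟨Measure.smul_absolutelyContinuous, Measure.absolutelyContinuous_smul ?_⟩
  have := e.isUnit_det'.ne_zero
  simp [this]

/-- The law is the image of the standard Gaussian under the invertible square root of `R`, and
invertible linear maps preserve Lebesgue null sets. -/
theorem multivariateGaussian_absolutelyContinuous {p : ℕ} {R : Matrix (Fin p) (Fin p) ℝ}
    (hR : R.PosDef) : multivariateGaussian 0 R ≪ volume ∧ volume ≪ multivariateGaussian 0 R := by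
  obtain ⟨e, he⟩ := hR.exists_linearEquiv_sqrt
  have hm : Measurable e := e.toLinearMap.continuous_of_finiteDimensional.measurable
  have : multivariateGaussian 0 R = (stdGaussian (EuclideanSpace ℝ (Fin p))).map e := by
    unfold multivariateGaussian
    congr 1
    ext1 x
    rw [he, zero_add]
  rw [this]
  exact ⟨((stdGaussian_absolutelyContinuous p).map hm).trans e.absolutelyContinuous_map_volume.1,
    e.absolutelyContinuous_map_volume.2.trans ((absolutelyContinuous_stdGaussian p).map hm)⟩

/-- The sum of a random vector and an independent one, whose law has the same null sets as an
invariant measure, has a law with the same null sets. -/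
theorem ProbabilityTheory.IndepFun.absolutelyContinuous_map_add {Ω G : Type*} [MeasurableSpace Ω]
    {P : Measure Ω} [IsProbabilityMeasure P] [AddGroup G] [MeasurableSpace G] [MeasurableAdd₂ G]
    [MeasurableNeg G] {ρ : Measure G} [SFinite ρ] [ρ.IsAddLeftInvariant] {X V : Ω → G}
    (hX : Measurable X) (hV : Measurable V) (hXV : IndepFun X V P)
    (h₁ : P.map V ≪ ρ) (h₂ : ρ ≪ P.map V) :
    P.map (fun ω => X ω + V ω) ≪ ρ ∧ ρ ≪ P.map (fun ω => X ω + V ω) := by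
  have := Measure.isProbabilityMeasure_map (μ := P) hX.aemeasurable
  have := Measure.isProbabilityMeasure_map (μ := P) hV.aemeasurable
  have hadd : Measurable fun z : G × G => z.1 + z.2 := measurable_add
  have e1 : P.map (fun ω => X ω + V ω) = ((P.map X).prod (P.map V)).map fun z => z.1 + z.2 := by
    rw [← (indepFun_iff_map_prod_eq_prod_map_map hX.aemeasurable hV.aemeasurable).1 hXV,
      Measure.map_map hadd (hX.prodMk hV)]
    rfl
  -- Convolving an invariant measure with a probability law leaves it unchanged.
  have e2 : ρ = ((P.map X).prod ρ).map fun z => z.1 + z.2 := by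
    have h := (measurePreserving_prod_add (P.map X) ρ).map_eq
    have : (fun z : G × G => z.1 + z.2) = Prod.snd ∘ fun z : G × G => (z.1, z.1 + z.2) := rfl
    rw [this, ← Measure.map_map measurable_snd (by fun_prop), h, Measure.map_snd_prod]
    simp
  rw [e1]
  constructor
  · conv_rhs => rw [e2]
    exact (Measure.AbsolutelyContinuous.rfl.prod h₁).map hadd
  · conv_lhs => rw [e2]
    exact (Measure.AbsolutelyContinuous.rfl.prod h₂).map hadd

/-! ### Laws and covariances of the records. -/

namespace UncertainLinear.Model

variable {n p M : ℕ} (S : Model n p M)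

theorem state_eq_pow_add (δ : ℝ) (𝒜 : Matrix (Fin n) (Fin n) ℝ) (x₀ : EuclideanSpace ℝ (Fin n))
    (w : ℕ → EuclideanSpace ℝ (Fin n)) (k : ℕ) :
    S.state δ 𝒜 x₀ w k =
      (Matrix.toEuclideanLin (S.trans δ 𝒜) ^ k) x₀ + S.state δ 𝒜 0 w k := by
  induction k with
  | zero => simp [state]
  | succ k ih => simp only [state]; rw [ih, map_add, pow_succ', Module.End.mul_apply, add_assoc]

theorem state_zero_noise (δ : ℝ) (𝒜 : Matrix (Fin n) (Fin n) ℝ) (x₀ : EuclideanSpace ℝ (Fin n))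
    (k : ℕ) : S.state δ 𝒜 x₀ 0 k = (Matrix.toEuclideanLin (S.trans δ 𝒜) ^ k) x₀ := by
  induction k with
  | zero => simp [state]
  | succ k ih => simp only [state]; rw [ih, pow_succ', Module.End.mul_apply]; simp

theorem output_zero_noise (δ : ℝ) (𝒜 : Matrix (Fin n) (Fin n) ℝ) (x₀ : EuclideanSpace ℝ (Fin n))
    (k : ℕ) : S.output δ 𝒜 x₀ 0 0 k =
      Matrix.toEuclideanLin S.C ((Matrix.toEuclideanLin (S.trans δ 𝒜) ^ k) x₀) := by
  simp [output, state_zero_noise]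

theorem measurable_toEuclideanLin {m l : ℕ} (A : Matrix (Fin m) (Fin l) ℝ) :
    Measurable (Matrix.toEuclideanLin A) :=
  (Matrix.toEuclideanLin A).continuous_of_finiteDimensional.measurable

theorem measurable_state (δ : ℝ) (𝒜 : Matrix (Fin n) (Fin n) ℝ) (k : ℕ) :
    Measurable fun z : EuclideanSpace ℝ (Fin n) × (ℕ → EuclideanSpace ℝ (Fin n)) =>
      S.state δ 𝒜 z.1 z.2 k := by
  induction k with
  | zero => exact measurable_fst
  | succ k ih =>
    exact ((measurable_toEuclideanLin _).comp ih).add ((measurable_pi_apply k).comp measurable_snd)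

variable {Ω : Type*} [MeasurableSpace Ω] {P : Measure Ω}
  {x₀ : Ω → EuclideanSpace ℝ (Fin n)} {w : ℕ → Ω → EuclideanSpace ℝ (Fin n)}
  {v : ℕ → Ω → EuclideanSpace ℝ (Fin p)}

variable {S}

theorem IsNoise.measurable_w_seq (h : S.IsNoise P x₀ w v) : Measurable fun ω k => w k ω :=
  measurable_pi_lambda _ h.measurable_w

theorem IsNoise.measurable_v_seq (h : S.IsNoise P x₀ w v) : Measurable fun ω k => v k ω :=
  measurable_pi_lambda _ h.measurable_v

theorem IsNoise.measurable_state (h : S.IsNoise P x₀ w v) (δ : ℝ) (𝒜 : Matrix (Fin n) (Fin n) ℝ)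
    (k : ℕ) : Measurable fun ω => S.state δ 𝒜 (x₀ ω) (fun m => w m ω) k :=
  (S.measurable_state δ 𝒜 k).comp (h.measurable_x₀.prodMk h.measurable_w_seq)

theorem IsNoise.measurable_record (h : S.IsNoise P x₀ w v) (d : Fin M → ℝ) (i : Fin M) (k : ℕ) :
    Measurable (S.record d x₀ w v i k) :=
  measurable_pi_lambda _ fun j =>
    ((measurable_toEuclideanLin _).comp (h.measurable_state _ _ j)).add (h.measurable_v j)

/-- The measurement noise is independent of the initial state and the process noise. -/
theorem IsNoise.indepFun_x₀_w_v [IsProbabilityMeasure P] (h : S.IsNoise P x₀ w v) :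
    IndepFun (fun ω => (x₀ ω, fun k => w k ω)) (fun ω k => v k ω) P := by
  have hx := h.measurable_x₀
  have hw := h.measurable_w_seq
  have hv := h.measurable_v_seq
  have := Measure.isProbabilityMeasure_map (μ := P) hx.aemeasurable
  have := Measure.isProbabilityMeasure_map (μ := P) hw.aemeasurable
  have := Measure.isProbabilityMeasure_map (μ := P) hv.aemeasurable
  have hxw : IndepFun x₀ (fun ω k => w k ω) P := h.indep_x₀.comp measurable_id measurable_fst
  rw [indepFun_iff_map_prod_eq_prod_map_map (hx.prodMk hw).aemeasurable hv.aemeasurable,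
    (indepFun_iff_map_prod_eq_prod_map_map hx.aemeasurable hw.aemeasurable).1 hxw]
  have e := (indepFun_iff_map_prod_eq_prod_map_map hx.aemeasurable
    (hw.prodMk hv).aemeasurable).1 h.indep_x₀
  rw [(indepFun_iff_map_prod_eq_prod_map_map hw.aemeasurable hv.aemeasurable).1 h.indep_w_v] at e
  have a := (measurePreserving_prodAssoc (P.map x₀) (P.map fun ω k => w k ω)
    (P.map fun ω k => v k ω)).symm.map_eq
  rw [← a, ← e, Measure.map_map (MeasurableEquiv.measurable _) (hx.prodMk (hw.prodMk hv))]
  rfl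

/-- The law of the record has the same null sets as Lebesgue measure. -/
theorem IsNoise.absolutelyContinuous_map_record [IsProbabilityMeasure P] (h : S.IsNoise P x₀ w v)
    (d : Fin M → ℝ) (i : Fin M) (k : ℕ) :
    P.map (S.record d x₀ w v i k) ≪ volume ∧ volume ≪ P.map (S.record d x₀ w v i k) := by
  let f : EuclideanSpace ℝ (Fin n) × (ℕ → EuclideanSpace ℝ (Fin n)) →
      Fin (k + 1) → EuclideanSpace ℝ (Fin p) :=
    fun z j => Matrix.toEuclideanLin S.C (S.state (d i) (S.loc i) z.1 z.2 j)
  let g : (ℕ → EuclideanSpace ℝ (Fin p)) → Fin (k + 1) → EuclideanSpace ℝ (Fin p) :=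
    fun z j => z j
  have hf : Measurable f := measurable_pi_lambda _ fun j =>
    (measurable_toEuclideanLin _).comp (S.measurable_state _ _ j)
  have hg : Measurable g := measurable_pi_lambda _ fun j => measurable_pi_apply _
  have hlaw : P.map (g ∘ fun ω k => v k ω) =
      Measure.pi fun j : Fin (k + 1) => multivariateGaussian 0 (S.R j) := by
    have := (iIndepFun_iff_map_fun_eq_pi_map fun j : Fin (k + 1) =>
      (h.measurable_v j).aemeasurable).1 (h.indep_v.precomp Fin.val_injective)
    simp_rw [h.law_v] at this
    exact this
  have hrec : S.record d x₀ w v i k = fun ω =>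
      (f ∘ fun ω => (x₀ ω, fun k => w k ω)) ω + (g ∘ fun ω k => v k ω) ω := rfl
  rw [hrec]
  refine (h.indepFun_x₀_w_v.comp hf hg).absolutelyContinuous_map_add
    (hf.comp (h.measurable_x₀.prodMk h.measurable_w_seq)) (hg.comp h.measurable_v_seq) ?_ ?_
  · rw [hlaw, volume_pi]
    exact Measure.AbsolutelyContinuous.pi_fin fun j =>
      (multivariateGaussian_absolutelyContinuous (S.R_posDef j)).1
  · rw [hlaw, volume_pi]
    exact Measure.AbsolutelyContinuous.pi_fin fun j =>
      (multivariateGaussian_absolutelyContinuous (S.R_posDef j)).2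

theorem memLp_two_of_map_multivariateGaussian {m : ℕ} {X : Ω → EuclideanSpace ℝ (Fin m)}
    (hX : Measurable X) {Q : Matrix (Fin m) (Fin m) ℝ} (h : P.map X = multivariateGaussian 0 Q) :
    MemLp X 2 P := by
  have : MemLp id 2 (P.map X) := by rw [h]; exact IsGaussian.memLp_two_id
  exact (memLp_map_measure_iff aestronglyMeasurable_id hX.aemeasurable).1 this

theorem memLp_toEuclideanLin {m l : ℕ} (A : Matrix (Fin m) (Fin l) ℝ)
    {X : Ω → EuclideanSpace ℝ (Fin l)} (hX : MemLp X 2 P) :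
    MemLp (fun ω => Matrix.toEuclideanLin A (X ω)) 2 P :=
  (LinearMap.toContinuousLinearMap (Matrix.toEuclideanLin A)).comp_memLp' hX

theorem IsNoise.memLp_state_zero [IsProbabilityMeasure P] (h : S.IsNoise P x₀ w v) (δ : ℝ)
    (𝒜 : Matrix (Fin n) (Fin n) ℝ) (k : ℕ) :
    MemLp (fun ω => S.state δ 𝒜 0 (fun m => w m ω) k) 2 P := by
  induction k with
  | zero => simp [state]
  | succ k ih =>
    exact (memLp_toEuclideanLin _ ih).add
      (memLp_two_of_map_multivariateGaussian (h.measurable_w k) (h.law_w k))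

open scoped RealInnerProductSpace

/-- The covariance between an output and the initial output. -/
theorem IsNoise.covariance_output [IsProbabilityMeasure P] (h : S.IsNoise P x₀ w v) (δ : ℝ)
    (𝒜 : Matrix (Fin n) (Fin n) ℝ) (a b : EuclideanSpace ℝ (Fin p)) (k : ℕ) :
    cov[fun ω => ⟪a, S.output δ 𝒜 (x₀ ω) (fun m => w m ω) (fun m => v m ω) k⟫,
      fun ω => ⟪b, S.output δ 𝒜 (x₀ ω) (fun m => w m ω) (fun m => v m ω) 0⟫; P] =
    ⟪a, Matrix.toEuclideanLin S.C ((Matrix.toEuclideanLin (S.trans δ 𝒜) ^ k)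
      (Matrix.toEuclideanLin S.P₀ (Matrix.toEuclideanLin S.C.transpose b)))⟫ +
    cov[fun ω => ⟪a, v k ω⟫, fun ω => ⟪b, v 0 ω⟫; P] := by
  set F := Matrix.toEuclideanLin (S.trans δ 𝒜)
  set C := Matrix.toEuclideanLin S.C
  set N : (ℕ → EuclideanSpace ℝ (Fin n)) → EuclideanSpace ℝ (Fin n) :=
    fun z => S.state δ 𝒜 0 z k
  have hN : Measurable N := (S.measurable_state δ 𝒜 k).comp (measurable_const.prodMk measurable_id)
  have mx := memLp_two_of_map_multivariateGaussian h.measurable_x₀ h.law_x₀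
  have mv (j) := memLp_two_of_map_multivariateGaussian (h.measurable_v j) (h.law_v j)
  have mN : MemLp (fun ω => N fun m => w m ω) 2 P := h.memLp_state_zero δ 𝒜 k
  let fX : EuclideanSpace ℝ (Fin n) →L[ℝ] ℝ :=
    (innerSL ℝ a).comp (LinearMap.toContinuousLinearMap (C ∘ₗ F ^ k))
  let fN : EuclideanSpace ℝ (Fin n) →L[ℝ] ℝ :=
    (innerSL ℝ a).comp (LinearMap.toContinuousLinearMap C)
  let gX : EuclideanSpace ℝ (Fin n) →L[ℝ] ℝ :=
    (innerSL ℝ b).comp (LinearMap.toContinuousLinearMap C)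
  have m1 : MemLp (fun ω => fX (x₀ ω)) 2 P := fX.comp_memLp' mx
  have m2 : MemLp (fun ω => fN (N fun m => w m ω)) 2 P := fN.comp_memLp' mN
  have m3 : MemLp (fun ω => ⟪a, v k ω⟫) 2 P := (innerSL ℝ a).comp_memLp' (mv k)
  have m4 : MemLp (fun ω => gX (x₀ ω)) 2 P := gX.comp_memLp' mx
  have m5 : MemLp (fun ω => ⟪b, v 0 ω⟫) 2 P := (innerSL ℝ b).comp_memLp' (mv 0)
  have e1 : (fun ω => ⟪a, S.output δ 𝒜 (x₀ ω) (fun m => w m ω) (fun m => v m ω) k⟫) =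
      (fun ω => fX (x₀ ω)) + ((fun ω => fN (N fun m => w m ω)) + fun ω => ⟪a, v k ω⟫) := by
    ext ω
    simp only [output, Pi.add_apply]
    rw [state_eq_pow_add, map_add, inner_add_right, inner_add_right, add_assoc]
    rfl
  have e2 : (fun ω => ⟪b, S.output δ 𝒜 (x₀ ω) (fun m => w m ω) (fun m => v m ω) 0⟫) =
      (fun ω => gX (x₀ ω)) + fun ω => ⟪b, v 0 ω⟫ := by
    ext ω
    simp only [output, Pi.add_apply, state]
    rw [inner_add_right]
    rfl
  have mb (j) (c : EuclideanSpace ℝ (Fin p)) :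
      Measurable fun z : ℕ → EuclideanSpace ℝ (Fin p) => ⟪c, z j⟫ :=
    (innerSL ℝ c).measurable.comp (measurable_pi_apply j)
  have i1 : IndepFun (fun ω => fX (x₀ ω)) (fun ω => ⟪b, v 0 ω⟫) P :=
    h.indep_x₀.comp fX.measurable ((mb 0 b).comp measurable_snd)
  have i2 : IndepFun (fun ω => fN (N fun m => w m ω)) (fun ω => gX (x₀ ω)) P :=
    (h.indep_x₀.comp gX.measurable ((fN.measurable.comp hN).comp measurable_fst)).symm
  have i3 : IndepFun (fun ω => fN (N fun m => w m ω)) (fun ω => ⟪b, v 0 ω⟫) P :=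
    h.indep_w_v.comp (fN.measurable.comp hN) (mb 0 b)
  have i4 : IndepFun (fun ω => ⟪a, v k ω⟫) (fun ω => gX (x₀ ω)) P :=
    (h.indep_x₀.comp gX.measurable ((mb k a).comp measurable_snd)).symm
  -- Of the six terms of the bilinear expansion the four mixed ones vanish by independence; only
  -- `x₀` with `x₀` and `v k` with `v 0` remain.
  rw [e1, e2, covariance_add_left m1 (m2.add m3) (m4.add m5), covariance_add_left m2 m3 (m4.add m5),
    covariance_add_right m1 m4 m5, covariance_add_right m2 m4 m5, covariance_add_right m3 m4 m5,
    i1.covariance_eq_zero m1 m5, i2.covariance_eq_zero m2 m4, i3.covariance_eq_zero m2 m5,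
    i4.covariance_eq_zero m3 m4]
  simp only [add_zero, zero_add]
  congr 1
  have e3 : (fun ω => fX (x₀ ω)) = fun ω => ⟪LinearMap.adjoint (C ∘ₗ F ^ k) a, x₀ ω⟫ := by
    ext ω
    rw [LinearMap.adjoint_inner_left]
    rfl
  have e4 : (fun ω => gX (x₀ ω)) = fun ω => ⟪LinearMap.adjoint C b, x₀ ω⟫ := by
    ext ω
    rw [LinearMap.adjoint_inner_left]
    rfl
  have hC : LinearMap.adjoint C = Matrix.toEuclideanLin S.C.transpose := by
    rw [← Matrix.toEuclideanLin_conjTranspose_eq_adjoint, Matrix.conjTranspose_eq_transpose_of_trivial]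
  rw [e3, e4, ← covariance_map_fun (X := fun u => ⟪LinearMap.adjoint (C ∘ₗ F ^ k) a, u⟫)
    (Y := fun u => ⟪LinearMap.adjoint C b, u⟫) (by fun_prop) (by fun_prop)
    h.measurable_x₀.aemeasurable, h.law_x₀,
    ← covarianceBilin_apply_eq_cov IsGaussian.memLp_two_id,
    covarianceBilin_multivariateGaussian S.P₀_posDef.posSemidef, hC]
  trans ⟪LinearMap.adjoint (C ∘ₗ F ^ k) a,
    Matrix.toEuclideanLin S.P₀ (Matrix.toEuclideanLin S.C.transpose b)⟫
  · rw [EuclideanSpace.inner_eq_star_dotProduct, dotProduct_comm]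
    simp
  · rw [LinearMap.adjoint_inner_left]
    rfl

/-- Observability separates the laws of the records of different locations. -/
theorem IsNoise.map_record_ne [IsProbabilityMeasure P] (h : S.IsNoise P x₀ w v)
    {d : Fin M → ℝ} (hd : ∀ i, d i ∈ S.Δ) {K : ℕ} (hobs : S.Observable K) {k : ℕ} (hk : K ≤ k) {i t : Fin M} (hit : i ≠ t) :
    P.map (S.record d x₀ w v t k) ≠ P.map (S.record d x₀ w v i k) := by
  intro heq
  have hne := S.loc_injective.ne hit
  have not_indist (z : EuclideanSpace ℝ (Fin n)) (hz : z ≠ 0)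
      (hind : S.Indistinguishable K (z, d t, S.loc t) (z, d i, S.loc i)) : False := by
    have h1 := hobs (z, d t, S.loc t) ⟨hd t, t, rfl⟩ hz
    have h2 : (z, d i, S.loc i) ∈
        {b ∈ S.triplets | S.Indistinguishable K (z, d t, S.loc t) b} := ⟨⟨hd i, i, rfl⟩, hind⟩
    rw [h1, Set.mem_singleton_iff] at h2
    exact hne (congrArg (fun a => a.2.2) h2)
  -- Equal laws have equal covariances of `y_j` and `y_0`; the measurement-noise term is common and
  -- cancels.
  have hagree (b : EuclideanSpace ℝ (Fin p)) :
      S.Indistinguishable K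
        (Matrix.toEuclideanLin S.P₀ (Matrix.toEuclideanLin S.C.transpose b), d t, S.loc t)
        (Matrix.toEuclideanLin S.P₀ (Matrix.toEuclideanLin S.C.transpose b), d i, S.loc i) := by
    intro j hj
    simp only [output_zero_noise]
    refine ext_inner_left ℝ fun a => ?_
    have hc (l : Fin M) : cov[fun Y : Fin (k + 1) → EuclideanSpace ℝ (Fin p) =>
        ⟪a, Y ⟨j, by omega⟩⟫, fun Y => ⟪b, Y 0⟫; P.map (S.record d x₀ w v l k)] =
        ⟪a, Matrix.toEuclideanLin S.C ((Matrix.toEuclideanLin (S.trans (d l) (S.loc l)) ^ j)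
          (Matrix.toEuclideanLin S.P₀ (Matrix.toEuclideanLin S.C.transpose b)))⟫ +
        cov[fun ω => ⟪a, v j ω⟫, fun ω => ⟪b, v 0 ω⟫; P] := by
      have hm (c : EuclideanSpace ℝ (Fin p)) (l : Fin (k + 1)) :
          Measurable fun Y : Fin (k + 1) → EuclideanSpace ℝ (Fin p) => ⟪c, Y l⟫ :=
        (innerSL ℝ c).measurable.comp (measurable_pi_apply l)
      rw [← h.covariance_output, covariance_map_fun (hm _ _).aestronglyMeasurable
        (hm _ _).aestronglyMeasurable
        (h.measurable_record d l k).aemeasurable]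
      rfl
    have := hc t
    rw [heq, hc i] at this
    linarith
  by_cases hz : ∃ b, Matrix.toEuclideanLin S.P₀ (Matrix.toEuclideanLin S.C.transpose b) ≠ 0
  · obtain ⟨b, hb⟩ := hz
    exact not_indist _ hb (hagree b)
  · push Not at hz
    have hCt : S.C.transpose = 0 := by
      apply Matrix.toEuclideanLin.injective
      rw [map_zero]
      ext1 b
      have hb := hz b
      rw [Matrix.toLpLin_apply, WithLp.toLp_eq_zero] at hb
      have := Matrix.mulVec_injective_of_isUnit S.P₀_posDef.isUnit
        (hb.trans (Matrix.mulVec_zero S.P₀).symm)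
      rw [Matrix.toLpLin_apply] at this ⊢
      simpa using this
    have hC : S.C = 0 := by rw [← Matrix.transpose_transpose S.C, hCt, Matrix.transpose_zero]
    -- With `C = 0` any nonzero state contradicts observability. One exists, because in dimension
    -- zero all location matrices coincide.
    have : Nonempty (Fin n) := by
      by_contra hn
      rw [not_nonempty_iff] at hn
      exact hne (Subsingleton.elim _ _)
    obtain ⟨z, hz⟩ := exists_ne (0 : EuclideanSpace ℝ (Fin n))
    exact not_indist z hz fun j _ => by simp [output_zero_noise, hC]

end UncertainLinear.Model

/-! ### Log-likelihood ratios and stationary sums. -/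

/-- The negated ratio is the logarithm of `dν/dμ`, and `log x ≤ x` bounds it by this integrable
density. -/
theorem MeasureTheory.integrable_max_neg_llr {α : Type*} [MeasurableSpace α] {μ ν : Measure α}
    [IsFiniteMeasure μ] [IsFiniteMeasure ν] (h : μ ≪ ν) :
    Integrable (fun x => max (-llr μ ν x) 0) μ := by
  refine (Measure.integrable_toReal_rnDeriv (μ := ν) (ν := μ)).mono'
    ((measurable_llr μ ν).neg.max measurable_const).aestronglyMeasurable ?_
  filter_upwards [neg_llr h] with x hx
  rw [Pi.neg_apply] at hx
  rw [hx, Real.norm_of_nonneg (le_max_right _ _)]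
  exact max_le (Real.log_le_self ENNReal.toReal_nonneg) ENNReal.toReal_nonneg

theorem InformationTheory.integral_llr_pos_of_ne {α : Type*} [MeasurableSpace α]
    {μ ν : Measure α} [IsProbabilityMeasure μ] [IsProbabilityMeasure ν] (hac : μ ≪ ν)
    (hint : Integrable (llr μ ν) μ) (hne : μ ≠ ν) : 0 < ∫ x, llr μ ν x ∂μ := by
  have h := pos_iff_ne_zero.2 fun h => hne ((klDiv_eq_zero_iff (μ := μ) (ν := ν)).1 h)
  rw [klDiv_of_ac_of_integrable hac hint] at h
  simpa using h

theorem MeasureTheory.MeasurePreserving.integrable_birkhoffSum {α : Type*} [MeasurableSpace α]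
    {μ : Measure α} {T : α → α} (hT : MeasurePreserving T μ μ) {f : α → ℝ} (hf : Integrable f μ)
    (n : ℕ) : Integrable (birkhoffSum T f n) μ :=
  integrable_finsetSum _ fun k _ => (hT.iterate k).integrable_comp_of_integrable hf

theorem MeasureTheory.MeasurePreserving.integral_birkhoffSum {α : Type*} [MeasurableSpace α]
    {μ : Measure α} {T : α → α} (hT : MeasurePreserving T μ μ) {f : α → ℝ} (hf : Integrable f μ)
    (n : ℕ) : ∫ x, birkhoffSum T f n x ∂μ = n * ∫ x, f x ∂μ := by
  have h (k : ℕ) : ∫ x, f (T^[k] x) ∂μ = ∫ x, f x ∂μ := by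
    conv_rhs => rw [← (hT.iterate k).map_eq]
    rw [integral_map (hT.iterate k).measurable.aemeasurable]
    rw [(hT.iterate k).map_eq]
    exact hf.aestronglyMeasurable
  have hi (k : ℕ) : Integrable (fun x => f (T^[k] x)) μ :=
    (hT.iterate k).integrable_comp_of_integrable hf
  simp only [birkhoffSum]
  rw [integral_finsetSum _ fun k _ => hi k]
  simp [h]

theorem birkhoffSum_shift (s : ℕ → ℝ) (n : ℕ) :
    birkhoffSum (fun (s : ℕ → ℝ) (k : ℕ) => s (k + 1)) (fun s => s 0) n s =
      ∑ j ∈ Finset.range n, s j := by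
  have h (j : ℕ) : ∀ (s : ℕ → ℝ) (m : ℕ),
      ((fun (s : ℕ → ℝ) (k : ℕ) => s (k + 1))^[j] s) m = s (m + j) := by
    induction j with
    | zero => simp
    | succ j ih => intro s m; rw [Function.iterate_succ_apply, ih, add_assoc]
  simp [birkhoffSum, h]

/-! ### Likelihoods along the true record. -/

namespace UncertainLinear.Model

variable {n p M : ℕ} {S : Model n p M} {Ω : Type*} [MeasurableSpace Ω] {P : Measure Ω}
  {x₀ : Ω → EuclideanSpace ℝ (Fin n)} {w : ℕ → Ω → EuclideanSpace ℝ (Fin n)}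
  {v : ℕ → Ω → EuclideanSpace ℝ (Fin p)}

theorem IsNoise.lik_pos [IsProbabilityMeasure P] (h : S.IsNoise P x₀ w v) (d : Fin M → ℝ)
    (i : Fin M) (k : ℕ) : ∀ᵐ Y, 0 < S.lik P d x₀ w v i k Y := by
  filter_upwards [Measure.rnDeriv_pos' (h.absolutelyContinuous_map_record d i k).2,
    Measure.rnDeriv_lt_top (P.map (S.record d x₀ w v i k)) volume] with Y h1 h2
  exact ENNReal.toReal_pos h1.ne' h2.ne

theorem IsNoise.lik_record_pos [IsProbabilityMeasure P] (h : S.IsNoise P x₀ w v) (d : Fin M → ℝ)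
    (t i : Fin M) : ∀ᵐ ω ∂P, ∀ k, 0 < S.lik P d x₀ w v i k (S.record d x₀ w v t k ω) :=
  ae_all_iff.2 fun k => ae_of_ae_map (h.measurable_record d t k).aemeasurable
    ((h.absolutelyContinuous_map_record d t k).1.ae_le (h.lik_pos d i k))

theorem IsNoise.log_lik_div_lik [IsProbabilityMeasure P] (h : S.IsNoise P x₀ w v) (d : Fin M → ℝ)
    (t i : Fin M) (k : ℕ) :
    (fun ω => Real.log (S.lik P d x₀ w v t k (S.record d x₀ w v t k ω) /
      S.lik P d x₀ w v i k (S.record d x₀ w v t k ω))) =ᵐ[P]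
    fun ω => llr (P.map (S.record d x₀ w v t k)) (P.map (S.record d x₀ w v i k))
      (S.record d x₀ w v t k ω) := by
  have ht := h.absolutelyContinuous_map_record d t k
  have hi := h.absolutelyContinuous_map_record d i k
  have := Measure.isProbabilityMeasure_map (μ := P) (h.measurable_record d t k).aemeasurable
  have := Measure.isProbabilityMeasure_map (μ := P) (h.measurable_record d i k).aemeasurable
  refine ae_of_ae_map (h.measurable_record d t k).aemeasurable
    (p := fun Y => Real.log (S.lik P d x₀ w v t k Y / S.lik P d x₀ w v i k Y) =
      llr (P.map (S.record d x₀ w v t k)) (P.map (S.record d x₀ w v i k)) Y) ?_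
  filter_upwards [(ht.1.trans hi.2).ae_le (Measure.rnDeriv_eq_div ht.1 hi.1)] with Y hY
  simp only [llr, lik, pdf]
  rw [hY, ENNReal.toReal_div]

/-- The transition matrix first acts at time `1`, so the log-likelihood ratio starts from zero. -/
theorem record_zero {Ω : Type*} {x₀ : Ω → EuclideanSpace ℝ (Fin n)}
    {w : ℕ → Ω → EuclideanSpace ℝ (Fin n)} {v : ℕ → Ω → EuclideanSpace ℝ (Fin p)}
    (d : Fin M → ℝ) (t i : Fin M) :
    S.record d x₀ w v t 0 = S.record d x₀ w v i 0 := by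
  ext1 ω
  funext j
  obtain rfl : j = 0 := Fin.fin_one_eq_zero j
  rfl

/-- The log-likelihood ratio is the sum of its increments. -/
theorem IsNoise.sum_llrIncrement [IsProbabilityMeasure P] (h : S.IsNoise P x₀ w v) (d : Fin M → ℝ)
    (t i : Fin M) : ∀ᵐ ω ∂P, ∀ k,
      ∑ j ∈ Finset.range k, S.llrIncrement P d x₀ w v t i j ω =
        Real.log (S.lik P d x₀ w v t k (S.record d x₀ w v t k ω) /
          S.lik P d x₀ w v i k (S.record d x₀ w v t k ω)) := by
  filter_upwards [h.lik_record_pos d t t, h.lik_record_pos d t i] with ω ht hi k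
  induction k with
  | zero =>
    have : S.lik P d x₀ w v t 0 = S.lik P d x₀ w v i 0 := by
      unfold lik
      rw [record_zero d t i]
    rw [← this, div_self (ht 0).ne']
    simp
  | succ k ih =>
    have hinit : Fin.init (S.record d x₀ w v t (k + 1) ω) = S.record d x₀ w v t k ω := rfl
    rw [Finset.sum_range_succ, ih]
    simp only [llrIncrement, condLik, hinit]
    have h1 := ht k
    have h2 := hi k
    have h3 := ht (k + 1)
    have h4 := hi (k + 1)
    rw [← Real.log_mul (by positivity) (by positivity)]
    congr 1
    field_simp

/-- If the increments of the log-likelihood ratio of the true location against another one are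
ergodic, and some record distinguishes the two, then the log-likelihood ratio tends to infinity. -/
theorem IsNoise.tendsto_sum_llrIncrement [IsProbabilityMeasure P] (h : S.IsNoise P x₀ w v)
    (d : Fin M → ℝ) {t i : Fin M} {k : ℕ}
    (hne : P.map (S.record d x₀ w v t k) ≠ P.map (S.record d x₀ w v i k))
    (herg : IsErgodicProcess P (S.llrIncrement P d x₀ w v t i)) :
    ∀ᵐ ω ∂P, Tendsto (fun k => ∑ j ∈ Finset.range k, S.llrIncrement P d x₀ w v t i j ω)
      atTop atTop := by
  obtain ⟨hmeas, herg⟩ := herg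
  have hZ : AEMeasurable (fun ω k => S.llrIncrement P d x₀ w v t i k ω) P :=
    aemeasurable_pi_iff.2 hmeas
  have := Measure.isProbabilityMeasure_map hZ
  have hac (k) : P.map (S.record d x₀ w v t k) ≪ P.map (S.record d x₀ w v i k) :=
    (h.absolutelyContinuous_map_record d t k).1.trans (h.absolutelyContinuous_map_record d i k).2
  have hrec (l k) := (h.measurable_record d l k).aemeasurable (μ := P)
  have hprob (l k) := Measure.isProbabilityMeasure_map (hrec l k)
  let T : (ℕ → ℝ) → ℕ → ℝ := fun s k => s (k + 1)
  let f : (ℕ → ℝ) → ℝ := fun s => s 0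
  have hf : Measurable f := measurable_pi_apply 0
  have hsum (m : ℕ) : (fun ω => birkhoffSum T f m fun k => S.llrIncrement P d x₀ w v t i k ω) =ᵐ[P]
      fun ω => llr (P.map (S.record d x₀ w v t m)) (P.map (S.record d x₀ w v i m))
        (S.record d x₀ w v t m ω) := by
    filter_upwards [h.sum_llrIncrement d t i, h.log_lik_div_lik d t i m] with ω h1 h2
    rw [birkhoffSum_shift, h1, h2]
  have key : ∀ᵐ s ∂(P.map fun ω k => S.llrIncrement P d x₀ w v t i k ω),
      Tendsto (fun n => birkhoffSum T f n s) atTop atTop := by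
    -- Ergodicity does not include integrability of the increments, so both cases occur.
    by_cases hint : Integrable f (P.map fun ω k => S.llrIncrement P d x₀ w v t i k ω)
    · refine herg.tendsto_birkhoffSum_atTop hf hint ?_
      have hB := herg.toMeasurePreserving.integrable_birkhoffSum hint k
      have hI := herg.toMeasurePreserving.integral_birkhoffSum hint k
      rw [integral_map hZ hB.aestronglyMeasurable, integral_congr_ae (hsum k),
        ← integral_map (hrec t k) (measurable_llr _ _).aestronglyMeasurable] at hI
      have hint' : Integrable (llr (P.map (S.record d x₀ w v t k)) (P.map (S.record d x₀ w v i k)))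
          (P.map (S.record d x₀ w v t k)) :=
        (integrable_map_measure (measurable_llr _ _).aestronglyMeasurable (hrec t k)).2
          ((hB.comp_aemeasurable hZ).congr (hsum k))
      have hpos := InformationTheory.integral_llr_pos_of_ne (hac k) hint' hne
      rw [hI] at hpos
      exact pos_of_mul_pos_right hpos k.cast_nonneg
    · refine herg.tendsto_birkhoffSum_atTop_of_not_integrable hf ?_ hint
      rw [integrable_map_measure (by fun_prop) hZ]
      -- The first increment is itself the log-likelihood ratio of the records at time `1`.
      refine (((integrable_max_neg_llr (hac 1)).comp_aemeasurable (hrec t 1))).congr ?_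
      filter_upwards [hsum 1] with ω hω
      rw [birkhoffSum_one] at hω
      simp only [Function.comp_apply, ← hω]
  filter_upwards [ae_of_ae_map hZ key] with ω hω
  simpa only [birkhoffSum_shift, T, f] using hω

/-- Under a uniform prior the ratio of two posterior probabilities is the likelihood ratio. -/
theorem posterior_div_posterior {d : Fin M → ℝ} {prior : PMF (Fin M)}
    (hprior : ∀ i, prior i = (M : ENNReal)⁻¹) {t : Fin M} (i : Fin M) {k : ℕ}
    {Y : Fin (k + 1) → EuclideanSpace ℝ (Fin p)} (ht : 0 < S.lik P d x₀ w v t k Y) :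
    S.posterior P d x₀ w v prior t k Y / S.posterior P d x₀ w v prior i k Y =
      S.lik P d x₀ w v t k Y / S.lik P d x₀ w v i k Y := by
  have hM : (0 : ℝ) < M := by exact_mod_cast t.pos
  have hp (j) : (prior j).toReal = (M : ℝ)⁻¹ := by simp [hprior j]
  have hsum : 0 < ∑ j, (prior j).toReal * S.lik P d x₀ w v j k Y :=
    Finset.sum_pos' (fun j _ => mul_nonneg ENNReal.toReal_nonneg ENNReal.toReal_nonneg)
      ⟨t, Finset.mem_univ t, by rw [hp]; positivity⟩
  unfold posterior
  rw [div_div_div_cancel_right₀ hsum.ne', hp, hp, mul_div_mul_left _ _ (by positivity)]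

end UncertainLinear.Model

/-! ### The main theorem. -/

theorem theorem3 {n p M : ℕ} (S : UncertainLinear.Model n p M)
    {Ω : Type*} [MeasurableSpace Ω] (P : Measure Ω) [IsProbabilityMeasure P]
    (x₀ : Ω → EuclideanSpace ℝ (Fin n)) (w : ℕ → Ω → EuclideanSpace ℝ (Fin n))
    (v : ℕ → Ω → EuclideanSpace ℝ (Fin p)) (hnoise : S.IsNoise P x₀ w v)
    (d : Fin M → ℝ) (hd : ∀ i, d i ∈ S.Δ) (t : Fin M)
    (K : ℕ) (hobs : S.Observable K) :
    (∀ k, K ≤ k → ∀ i, i ≠ t →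
      0 < InformationTheory.klDiv (P.map (S.record d x₀ w v t k))
        (P.map (S.record d x₀ w v i k))) ∧
    ∀ prior : PMF (Fin M), (∀ i, prior i = (M : ENNReal)⁻¹) →
      (∀ i, UncertainLinear.IsErgodicProcess P (S.llrIncrement P d x₀ w v t i)) →
      ∀ i, i ≠ t →
        (∀ᵐ ω ∂P, ∃ L : EReal, 1 < L ∧
          Tendsto (fun k => ((S.posterior P d x₀ w v prior t k (S.record d x₀ w v t k ω) /
            S.posterior P d x₀ w v prior i k (S.record d x₀ w v t k ω) : ℝ) : EReal))
            atTop (𝓝 L)) ∧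
        (∀ᵐ ω ∂P,
          Tendsto (fun k => S.posterior P d x₀ w v prior t k (S.record d x₀ w v t k ω) /
            S.posterior P d x₀ w v prior i k (S.record d x₀ w v t k ω))
            atTop atTop) := by
  refine ⟨fun k hk i hi => ?_, fun prior hprior herg i hi => ?_⟩
  · have := Measure.isProbabilityMeasure_map (hnoise.measurable_record d t k).aemeasurable (μ := P)
    have := Measure.isProbabilityMeasure_map (hnoise.measurable_record d i k).aemeasurable (μ := P)
    exact pos_iff_ne_zero.2 fun h =>
      hnoise.map_record_ne hd hobs hk hi (InformationTheory.klDiv_eq_zero_iff.1 h)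
  · have key : ∀ᵐ ω ∂P,
        Tendsto (fun k => S.posterior P d x₀ w v prior t k (S.record d x₀ w v t k ω) /
          S.posterior P d x₀ w v prior i k (S.record d x₀ w v t k ω)) atTop atTop := by
      filter_upwards [hnoise.tendsto_sum_llrIncrement d
        (hnoise.map_record_ne hd hobs le_rfl hi) (herg i), hnoise.sum_llrIncrement d t i,
        hnoise.lik_record_pos d t t, hnoise.lik_record_pos d t i] with ω hlim hsum ht hi'
      refine (Real.tendsto_exp_atTop.comp hlim).congr fun k => ?_
      rw [UncertainLinear.Model.posterior_div_posterior hprior i (ht k), Function.comp_apply, hsum k,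
        Real.exp_log (div_pos (ht k) (hi' k))]
    refine ⟨?_, key⟩
    filter_upwards [key] with ω hω
    exact ⟨⊤, by exact_mod_cast EReal.coe_lt_top 1, EReal.tendsto_coe_nhds_top_iff.2 hω⟩
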